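/- Let $q\ge 2$ be an integer. A trigonometric polynomial is a function $\theta(t)=\sum_{k=0}^{N}(a_k\cos kt+b_k\sin kt)$, $t\in\mathbb R$, with coefficients $a_k,b_k\in\mathbb C$. For a function $\theta:\mathbb R\to\mathbb C$ the following two statements are equivalent. (i) $\theta$ is a trigonometric polynomial, and there is a $2\pi$-periodic Lebesgue measurable function $\psi:\mathbb R\to\mathbb C$ such that $$\psi(t)-\psi(qt)=\theta(t)\qquad\text{for all } t\in\mathbb R.$$ (ii) There are an integer $d\ge 1$ and complex numbers $a_{p,i},b_{p,i}$ such that $$\theta(t)=\sum_{p\in I_d}\ \sum_{i=0}^{i_{p,d}}\bigl(a_{p,i}\cos(pq^i t)+b_{p,i}\sin(pq^i t)\bigr)\qquad(t\in\mathbb R),$$ where $I_d=\{p\in\mathbb Z: 1\le p\le d,\ p\not\equiv 0 \pmod q\}$ and $i_{p,d}=\min\{i\ge 0: pq^i>d\}$, and for every $p\in I_d$ $$\sum_{i=0}^{i_{p,d}}a_{p,i}=0,\qquad \sum_{i=0}^{i_{p,d}}b_{p,i}=0.$$ The equivalence also holds if in (i) the equation is required only for almost every $t\in\mathbb R$. 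-/

import Mathlib

/-- `θ : ℝ → ℂ` is a trigonometric polynomial in the variable `t` with period `2π`, with complex
coefficients; a constant term (the frequency `0`) is allowed. -/
def IsTrigPoly (θ : ℝ → ℂ) : Prop :=
  ∃ (N : ℕ) (a b : ℕ → ℂ), ∀ t : ℝ,
    θ t = ∑ k ∈ Finset.range (N + 1),
      (a k * (Real.cos ((k : ℝ) * t) : ℂ) + b k * (Real.sin ((k : ℝ) * t) : ℂ))

/-- A Lebesgue measurable complex function on the circle `ℝ / 2πℤ`, written as a `2π`-periodic
function on `ℝ`. Lebesgue measurable means that preimages of Borel sets are Lebesgue measurable,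
that is, null-measurable for the Lebesgue measure. -/
def IsMeasurableOnCircle (ψ : ℝ → ℂ) : Prop :=
  Function.Periodic ψ (2 * Real.pi) ∧
    MeasureTheory.NullMeasurable ψ MeasureTheory.volume

/-- A trigonometric polynomial `θ` such that `ψ(t) - ψ(qt) = θ(t)` has a measurable solution `ψ`
on the circle, the equation being satisfied at every point. -/
def IsTrigCoboundary (q : ℕ) (θ : ℝ → ℂ) : Prop :=
  IsTrigPoly θ ∧ ∃ ψ : ℝ → ℂ, IsMeasurableOnCircle ψ ∧
    ∀ t : ℝ, ψ t - ψ ((q : ℝ) * t) = θ t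

/-- The same, with the equation satisfied almost everywhere. -/
def IsTrigCoboundaryAE (q : ℕ) (θ : ℝ → ℂ) : Prop :=
  IsTrigPoly θ ∧ ∃ ψ : ℝ → ℂ, IsMeasurableOnCircle ψ ∧
    ∀ᵐ t : ℝ, ψ t - ψ ((q : ℝ) * t) = θ t

/-- `I_d = {p : 1 ≤ p ≤ d, p ≢ 0 (mod q)}`. -/
def baseFreqs (q d : ℕ) : Finset ℕ :=
  {p ∈ Finset.Icc 1 d | ¬ q ∣ p}

/-- `i_{p,d} = min {i ≥ 0 : p q ^ i > d}` (the set is nonempty when `p ≥ 1` and `q ≥ 2`). -/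
noncomputable def topExponent (q d p : ℕ) : ℕ :=
  sInf {i : ℕ | d < p * q ^ i}

/-- The explicit form: for some `d ≥ 1`, `θ` is the sum over `p ∈ I_d` and `0 ≤ i ≤ i_{p,d}` of
`a_{p,i} cos (p q^i t) + b_{p,i} sin (p q^i t)`, where for each `p ∈ I_d` the `a_{p,i}` sum to zero
and the `b_{p,i}` sum to zero. -/
def HasCoboundaryForm (q : ℕ) (θ : ℝ → ℂ) : Prop :=
  ∃ d : ℕ, 1 ≤ d ∧ ∃ a b : ℕ → ℕ → ℂ,
    (∀ p ∈ baseFreqs q d,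
      ∑ i ∈ Finset.range (topExponent q d p + 1), a p i = 0 ∧
      ∑ i ∈ Finset.range (topExponent q d p + 1), b p i = 0) ∧
    ∀ t : ℝ, θ t = ∑ p ∈ baseFreqs q d, ∑ i ∈ Finset.range (topExponent q d p + 1),
      (a p i * (Real.cos ((p : ℝ) * (q : ℝ) ^ i * t) : ℂ) +
        b p i * (Real.sin ((p : ℝ) * (q : ℝ) ^ i * t) : ℂ))

/-! Modulo coboundaries a frequency `p * q ^ i` may be lowered to `p`: the difference `g (q ^ i * t)
- g t` is a coboundary of a Birkhoff sum of `g` under `t ↦ q * t`. Each `θ` is thus cohomologous to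
`c + f`, where `f` has only frequencies prime to divisibility by `q` and its coefficients are the
sums along the orbits `p, p * q, p * q ^ 2, ...`. If these sums and `c` vanish, `θ` is a coboundary,
with a continuous `ψ` and at every point. The converse, already from an almost everywhere equation,
amounts to `c = 0` and `f = 0`.

Let `S n` be the Birkhoff sums. For a coboundary, `S n t = ψ t - ψ (q ^ n * t)` almost everywhere;
since `t ↦ q * t` preserves the measure on the circle, the `S n` stay bounded in measure, even if
`ψ` is not integrable. As `|S n|` is at most `n` times a constant, the mean is zero, so `c = 0`.
Next, `f` is orthogonal to every function of `q * t`, so its iterates behave like reversed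
martingale differences: `∫ ‖S n‖ ^ 2 = n * ∫ ‖f‖ ^ 2`, while `∫ ‖S n‖ ^ 4 = O(n ^ 2)`. The fourth
moment makes `‖S n‖ ^ 2 / n` uniformly integrable, and boundedness in measure makes it tend to zero
in measure. Hence `∫ ‖f‖ ^ 2 = 0` (`OrthToDilates.integral_norm_sq_eq_zero`), and continuity gives
`f = 0`. -/

/-! ### Invariance and orthogonality under dilation by `q` -/

open MeasureTheory in
/-- The integral over a period is invariant under `t ↦ q t`. -/
theorem integral_periodic_comp_mul {E : Type*} [NormedAddCommGroup E] [NormedSpace ℝ E]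
    {q : ℕ} (hq : q ≠ 0) {g : ℝ → E} (hper : Function.Periodic g (2 * Real.pi))
    (hint : ∀ a b, IntervalIntegrable g volume a b) :
    ∫ t in (0 : ℝ)..2 * Real.pi, g (q * t) = ∫ t in (0 : ℝ)..2 * Real.pi, g t := by
  have hq' : (q : ℝ) ≠ 0 := by exact_mod_cast hq
  have h := hper.intervalIntegral_add_zsmul_eq q 0 hint
  simp only [zero_add] at h
  rw [intervalIntegral.integral_comp_mul_left _ hq', mul_zero]
  have e : (q : ℝ) * (2 * Real.pi) = (q : ℤ) • (2 * Real.pi) := by simp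
  rw [e, h, natCast_zsmul, ← Nat.cast_smul_eq_nsmul ℝ, smul_smul, inv_mul_cancel₀ hq', one_smul]

theorem Function.Periodic.comp_natCast_mul {E : Type*} {g : ℝ → E} {T : ℝ}
    (hper : Function.Periodic g T) (q : ℕ) : Function.Periodic (fun t => g (q * t)) T := by
  intro t
  simp only [mul_add]
  exact hper.nat_mul q _

/-- Characters whose frequency is not divisible by `q` are orthogonal to functions of `q t`. -/
theorem integral_exp_mul_comp_mul_eq_zero {q : ℕ} (hq : q ≠ 0) {p : ℤ} (hp : ¬ (q : ℤ) ∣ p)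
    {g : ℝ → ℂ} (hper : Function.Periodic g (2 * Real.pi)) :
    ∫ t in (0 : ℝ)..2 * Real.pi, Complex.exp (p * t * Complex.I) * g (q * t) = 0 := by
  have hq' : (q : ℝ) ≠ 0 := by exact_mod_cast hq
  have hqc : (q : ℂ) ≠ 0 := by exact_mod_cast hq
  set H : ℝ → ℂ := fun t => Complex.exp (p * t * Complex.I) * g (q * t) with hH
  -- Translation by `2π / q` fixes `g (q * t)` and multiplies the character by `w`, so the integral
  -- equals `w` times itself; `w = 1` would force `q ∣ p`.
  set w : ℂ := Complex.exp (p * (2 * Real.pi / q) * Complex.I) with hw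
  have hw1 : w ≠ 1 := by
    rw [hw, Ne, Complex.exp_eq_one_iff]
    rintro ⟨n, hn⟩
    apply hp
    refine ⟨n, ?_⟩
    have hpi : (2 * Real.pi * Complex.I : ℂ) ≠ 0 := Complex.two_pi_I_ne_zero
    have : (p : ℂ) * (2 * Real.pi * Complex.I) = (q * n : ℂ) * (2 * Real.pi * Complex.I) := by
      have := congrArg (fun z => (q : ℂ) * z) hn
      field_simp at this
      linear_combination 2 * Real.pi * Complex.I * this
    exact_mod_cast mul_right_cancel₀ hpi this
  have hHper : Function.Periodic H (2 * Real.pi) := by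
    apply Function.Periodic.mul _ (hper.comp_natCast_mul q)
    intro t
    rw [Complex.exp_eq_exp_iff_exists_int]
    exact ⟨p, by push_cast; ring⟩
  have hshift : ∀ t, H (t + 2 * Real.pi / q) = w * H t := by
    intro t
    have e : (q : ℝ) * (t + 2 * Real.pi / q) = q * t + 2 * Real.pi := by field_simp
    simp only [hH, hw, e, hper _]
    rw [← mul_assoc, ← Complex.exp_add]
    congr 2
    push_cast
    ring
  have h1 : ∫ t in (0 : ℝ)..2 * Real.pi, H (t + 2 * Real.pi / q)
      = ∫ t in (0 : ℝ)..2 * Real.pi, H t := by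
    rw [intervalIntegral.integral_comp_add_right]
    have := hHper.intervalIntegral_add_eq (2 * Real.pi / q) 0
    rw [zero_add] at this
    rw [zero_add, add_comm, this]
  simp only [hshift, intervalIntegral.integral_const_mul] at h1
  have : (w - 1) * ∫ t in (0 : ℝ)..2 * Real.pi, H t = 0 := by
    rw [sub_mul, h1, one_mul, sub_self]
  exact (mul_eq_zero.1 this).resolve_left (sub_ne_zero.2 hw1)

/-! ### Second and fourth moments of Birkhoff sums -/

theorem continuous_birkhoffSum_mul {q : ℕ} {f : ℝ → ℂ} (hf : Continuous f) (n : ℕ) :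
    Continuous (birkhoffSum (fun t : ℝ => q * t) f n) := by
  induction n with
  | zero => rw [birkhoffSum_zero']; exact continuous_const
  | succ n ih =>
    have : birkhoffSum (fun t : ℝ => q * t) f (n + 1)
        = fun t => f t + birkhoffSum (fun t : ℝ => q * t) f n (q * t) :=
      funext fun t => birkhoffSum_succ' _ _ _ _
    rw [this]
    fun_prop

theorem periodic_birkhoffSum_mul {q : ℕ} {f : ℝ → ℂ} {T : ℝ} (hf : Function.Periodic f T)
    (n : ℕ) : Function.Periodic (birkhoffSum (fun t : ℝ => q * t) f n) T := by
  induction n with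
  | zero => intro t; simp
  | succ n ih =>
    intro t
    have h : birkhoffSum (fun t : ℝ => q * t) f n (q * (t + T))
        = birkhoffSum (fun t : ℝ => q * t) f n (q * t) := ih.comp_natCast_mul q t
    rw [birkhoffSum_succ', birkhoffSum_succ', hf, h]

/-- `f` is orthogonal to all functions of `q t`. -/
def OrthToDilates (q : ℕ) (f : ℝ → ℂ) : Prop :=
  ∀ g : ℝ → ℂ, Continuous g → Function.Periodic g (2 * Real.pi) →
    ∫ t in (0 : ℝ)..2 * Real.pi, f t * g (q * t) = 0

theorem OrthToDilates.integral_re_mul_eq_zero {q : ℕ} {f : ℝ → ℂ} (hf : Continuous f)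
    (ho : OrthToDilates q f) {g : ℝ → ℂ} (hg : Continuous g)
    (hper : Function.Periodic g (2 * Real.pi)) :
    ∫ t in (0 : ℝ)..2 * Real.pi, (f t * g (q * t)).re = 0 := by
  have hc : Continuous fun t : ℝ => f t * g (q * t) := by fun_prop
  have h := Complex.reCLM.intervalIntegral_comp_comm
    (μ := MeasureTheory.volume) (hc.intervalIntegrable 0 (2 * Real.pi))
  rw [ho g hg hper] at h
  simpa using h

theorem integral_birkhoffSum_mul {q : ℕ} (hq : q ≠ 0) {f : ℝ → ℂ} (hf : Continuous f)
    (hper : Function.Periodic f (2 * Real.pi)) (n : ℕ) :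
    ∫ t in (0 : ℝ)..2 * Real.pi, birkhoffSum (fun t : ℝ => q * t) f n t
      = n * ∫ t in (0 : ℝ)..2 * Real.pi, f t := by
  induction n with
  | zero => simp
  | succ n ih =>
    have hS := continuous_birkhoffSum_mul (q := q) hf n
    have hSq : Continuous fun t : ℝ => birkhoffSum (fun t : ℝ => q * t) f n (q * t) := by fun_prop
    simp only [birkhoffSum_succ']
    rw [intervalIntegral.integral_add (hf.intervalIntegrable _ _) (hSq.intervalIntegrable _ _),
      integral_periodic_comp_mul hq (periodic_birkhoffSum_mul hper n)
        (fun a b => hS.intervalIntegrable a b), ih]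
    push_cast
    ring

/-- In `S (n + 1) t = f t + S n (q * t)` the second summand is a function of `q * t`, so the cross
term integrates to zero, and invariance restores `∫ ‖S n‖ ^ 2`. -/
theorem integral_norm_sq_birkhoffSum {q : ℕ} (hq : q ≠ 0) {f : ℝ → ℂ} (hf : Continuous f)
    (hper : Function.Periodic f (2 * Real.pi)) (ho : OrthToDilates q f) (n : ℕ) :
    ∫ t in (0 : ℝ)..2 * Real.pi, ‖birkhoffSum (fun t : ℝ => q * t) f n t‖ ^ 2
      = n * ∫ t in (0 : ℝ)..2 * Real.pi, ‖f t‖ ^ 2 := by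
  induction n with
  | zero => simp
  | succ n ih =>
    set S := birkhoffSum (fun t : ℝ => q * t) f n with hSdef
    have hS : Continuous S := continuous_birkhoffSum_mul hf n
    have hSper : Function.Periodic S (2 * Real.pi) := periodic_birkhoffSum_mul hper n
    have hg : Continuous fun t => (starRingEnd ℂ) (S t) := Complex.continuous_conj.comp hS
    have hgp : Function.Periodic (fun t => (starRingEnd ℂ) (S t)) (2 * Real.pi) :=
      fun t => congrArg _ (hSper t)
    have hcross := ho.integral_re_mul_eq_zero hf hg hgp
    have e : ∀ t, ‖birkhoffSum (fun t : ℝ => q * t) f (n + 1) t‖ ^ 2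
        = ‖f t‖ ^ 2 + 2 * (f t * (starRingEnd ℂ) (S (q * t))).re + ‖S (q * t)‖ ^ 2 := by
      intro t
      rw [birkhoffSum_succ', ← Complex.normSq_eq_norm_sq, Complex.normSq_add,
        Complex.normSq_eq_norm_sq, Complex.normSq_eq_norm_sq]
      ring
    simp only [e]
    have c1 : Continuous fun t => ‖f t‖ ^ 2 := by fun_prop
    have c2 : Continuous fun t : ℝ => 2 * (f t * (starRingEnd ℂ) (S (q * t))).re := by fun_prop
    have c3 : Continuous fun t : ℝ => ‖S (q * t)‖ ^ 2 := by fun_prop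
    have c4 : Continuous fun t : ℝ => ‖S t‖ ^ 2 := by fun_prop
    rw [intervalIntegral.integral_add ((c1.fun_add c2).intervalIntegrable _ _)
        (c3.intervalIntegrable _ _),
      intervalIntegral.integral_add (c1.intervalIntegrable _ _) (c2.intervalIntegrable _ _),
      intervalIntegral.integral_const_mul, hcross,
      integral_periodic_comp_mul (g := fun t => ‖S t‖ ^ 2) hq
        (fun t => by simp only [hSper t]) (fun a b => c4.intervalIntegrable a b), ih]
    push_cast
    ring

/-- The term cubic in `w` is kept exactly, because orthogonality will annihilate its integral; the
remaining mixed terms are estimated. With `r = Re (z * conj w)`, the `8` is `2 + 4 + 2`, from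
`2‖z‖²‖w‖²`, from `4r²`, and from half of the bound for `4r‖z‖²`, whose other half raises `‖z‖⁴` to
`3‖z‖⁴`. -/
theorem norm_add_pow_four_le (z w : ℂ) {B : ℝ} (hz : ‖z‖ ≤ B) :
    ‖z + w‖ ^ 4 ≤ ‖w‖ ^ 4 + 4 * (z * ((starRingEnd ℂ) w * (‖w‖ ^ 2 : ℝ))).re
      + 8 * B ^ 2 * ‖w‖ ^ 2 + 3 * B ^ 4 := by
  set r := (z * (starRingEnd ℂ) w).re with hr
  have e : ‖z + w‖ ^ 2 = ‖z‖ ^ 2 + 2 * r + ‖w‖ ^ 2 := by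
    rw [← Complex.normSq_eq_norm_sq, Complex.normSq_add,
        Complex.normSq_eq_norm_sq, Complex.normSq_eq_norm_sq]
    ring
  have e2 : (z * ((starRingEnd ℂ) w * (‖w‖ ^ 2 : ℝ))).re = r * ‖w‖ ^ 2 := by
    rw [← mul_assoc, Complex.re_mul_ofReal]
  have hrle : |r| ≤ ‖z‖ * ‖w‖ := by
    have := Complex.abs_re_le_norm (z * (starRingEnd ℂ) w)
    rwa [norm_mul, RCLike.norm_conj] at this
  have e4 : ‖z + w‖ ^ 4 = (‖z‖ ^ 2 + 2 * r + ‖w‖ ^ 2) ^ 2 := by rw [← e]; ring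
  rw [e4, e2]
  have hz0 := norm_nonneg z
  have hw0 := norm_nonneg w
  generalize ‖z‖ = a at *
  generalize ‖w‖ = b at *
  have h1 : r ^ 2 ≤ a ^ 2 * b ^ 2 := by
    rw [← mul_pow]; exact sq_le_sq' (by linarith [neg_abs_le r]) (by linarith [le_abs_self r])
  have h2 : r * a ^ 2 ≤ (a * b) * a ^ 2 :=
    mul_le_mul_of_nonneg_right ((le_abs_self r).trans hrle) (by positivity)
  have h3 : 2 * (a * b) * a ^ 2 ≤ a ^ 2 * b ^ 2 + a ^ 4 := by nlinarith [sq_nonneg (a * b - a ^ 2)]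
  have h5 : a ^ 2 ≤ B ^ 2 := by gcongr
  have h6 : a ^ 4 ≤ B ^ 4 := by gcongr
  have h7 : a ^ 2 * b ^ 2 ≤ B ^ 2 * b ^ 2 := by gcongr
  nlinarith

/-- Once the cubic term is gone, the second moment bounds each increment by `16πB⁴n + 6πB⁴`, so the
growth is quadratic. -/
theorem integral_norm_pow_four_birkhoffSum_le {q : ℕ} (hq : q ≠ 0) {f : ℝ → ℂ} (hf : Continuous f)
    (hper : Function.Periodic f (2 * Real.pi)) (ho : OrthToDilates q f) {B : ℝ}
    (hB : ∀ t, ‖f t‖ ≤ B) (n : ℕ) :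
    ∫ t in (0 : ℝ)..2 * Real.pi, ‖birkhoffSum (fun t : ℝ => q * t) f n t‖ ^ 4
      ≤ 16 * Real.pi * B ^ 4 * n ^ 2 := by
  have hB0 : 0 ≤ B := (norm_nonneg _).trans (hB 0)
  have hσ : ∫ t in (0 : ℝ)..2 * Real.pi, ‖f t‖ ^ 2 ≤ 2 * Real.pi * B ^ 2 := by
    have : ∫ t in (0 : ℝ)..2 * Real.pi, ‖f t‖ ^ 2 ≤ ∫ t in (0 : ℝ)..2 * Real.pi, B ^ 2 := by
      apply intervalIntegral.integral_mono_on Real.two_pi_pos.le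
        ((by fun_prop : Continuous fun t => ‖f t‖ ^ 2).intervalIntegrable _ _)
        (continuous_const.intervalIntegrable _ _)
      intro t _
      have := hB t
      gcongr
    simpa using this
  induction n with
  | zero => simp
  | succ n ih =>
    have h2 := integral_norm_sq_birkhoffSum hq hf hper ho n
    set S := birkhoffSum (fun t : ℝ => q * t) f n with hSdef
    have hS : Continuous S := continuous_birkhoffSum_mul hf n
    have hSper : Function.Periodic S (2 * Real.pi) := periodic_birkhoffSum_mul hper n
    have hcross := ho.integral_re_mul_eq_zero hf
      (g := fun t => (starRingEnd ℂ) (S t) * (‖S t‖ ^ 2 : ℝ)) (by fun_prop)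
      (fun t => by simp only [hSper t])
    have c0 : Continuous fun t => ‖birkhoffSum (fun t : ℝ => q * t) f (n + 1) t‖ ^ 4 := by
      have := continuous_birkhoffSum_mul (q := q) hf (n + 1)
      fun_prop
    have c1 : Continuous fun t : ℝ => ‖S (q * t)‖ ^ 4 := by fun_prop
    have c2 : Continuous fun t : ℝ =>
        4 * (f t * ((starRingEnd ℂ) (S (q * t)) * (‖S (q * t)‖ ^ 2 : ℝ))).re := by fun_prop
    have c3 : Continuous fun t : ℝ => 8 * B ^ 2 * ‖S (q * t)‖ ^ 2 := by fun_prop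
    have c4 : Continuous fun _ : ℝ => 3 * B ^ 4 := continuous_const
    have c5 : Continuous fun t : ℝ => ‖S t‖ ^ 4 := by fun_prop
    have c6 : Continuous fun t : ℝ => ‖S t‖ ^ 2 := by fun_prop
    have hle : ∫ t in (0 : ℝ)..2 * Real.pi, ‖birkhoffSum (fun t : ℝ => q * t) f (n + 1) t‖ ^ 4
        ≤ ∫ t in (0 : ℝ)..2 * Real.pi, (‖S (q * t)‖ ^ 4
          + 4 * (f t * ((starRingEnd ℂ) (S (q * t)) * (‖S (q * t)‖ ^ 2 : ℝ))).re
          + 8 * B ^ 2 * ‖S (q * t)‖ ^ 2 + 3 * B ^ 4) := by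
      apply intervalIntegral.integral_mono_on Real.two_pi_pos.le (c0.intervalIntegrable _ _)
        ((((c1.fun_add c2).fun_add c3).fun_add c4).intervalIntegrable _ _)
      intro t _
      rw [birkhoffSum_succ']
      exact norm_add_pow_four_le _ _ (hB t)
    rw [intervalIntegral.integral_add (((c1.fun_add c2).fun_add c3).intervalIntegrable _ _)
        (c4.intervalIntegrable _ _),
      intervalIntegral.integral_add ((c1.fun_add c2).intervalIntegrable _ _)
        (c3.intervalIntegrable _ _),
      intervalIntegral.integral_add (c1.intervalIntegrable _ _) (c2.intervalIntegrable _ _),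
      intervalIntegral.integral_const_mul, intervalIntegral.integral_const_mul, hcross,
      integral_periodic_comp_mul (g := fun t => ‖S t‖ ^ 2) hq
        (fun t => by simp only [hSper t]) (fun a b => c6.intervalIntegrable a b),
      integral_periodic_comp_mul (g := fun t => ‖S t‖ ^ 4) hq
        (fun t => by simp only [hSper t]) (fun a b => c5.intervalIntegrable a b), h2,
      intervalIntegral.integral_const, smul_eq_mul] at hle
    have h3 : 8 * B ^ 2 * (n * ∫ t in (0 : ℝ)..2 * Real.pi, ‖f t‖ ^ 2)
        ≤ 8 * B ^ 2 * (n * (2 * Real.pi * B ^ 2)) := by gcongr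
    have h4 : 0 ≤ Real.pi * B ^ 4 := by positivity
    have h5 : 0 ≤ Real.pi * B ^ 4 * n := by positivity
    push_cast
    nlinarith

/-! ### Telescoping and cutoffs: boundedness in measure -/

open MeasureTheory in
theorem ae_comp_natCast_mul {q : ℕ} (hq : q ≠ 0) {P : ℝ → Prop} (h : ∀ᵐ t : ℝ, P t) :
    ∀ᵐ t : ℝ, P (q * t) := by
  have hq' : (q : ℝ) ≠ 0 := by exact_mod_cast hq
  exact (Measure.quasiMeasurePreserving_smul (volume : Measure ℝ) hq').ae h

/-- A measurable solution of the cohomological equation telescopes the Birkhoff sums. -/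
theorem ae_birkhoffSum_eq_sub {q : ℕ} (hq : q ≠ 0) {f ψ : ℝ → ℂ}
    (h : ∀ᵐ t : ℝ, ψ t - ψ (q * t) = f t) (n : ℕ) :
    ∀ᵐ t : ℝ, birkhoffSum (fun t : ℝ => q * t) f n t = ψ t - ψ ((q ^ n : ℕ) * t) := by
  induction n with
  | zero => simp
  | succ n ih =>
    filter_upwards [h, ae_comp_natCast_mul hq ih] with t h1 h2
    rw [birkhoffSum_succ', h2, ← h1, pow_succ]
    push_cast
    rw [mul_assoc]
    ring

/-- A bounded cutoff, at least `1` where `‖ψ‖ ≥ K`, tending to `0` as `K → ∞`. -/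
noncomputable def normCutoff (ψ : ℝ → ℂ) (K : ℕ) (t : ℝ) : ℝ :=
  min 1 (‖ψ t‖ / K)

theorem normCutoff_nonneg (ψ : ℝ → ℂ) (K : ℕ) (t : ℝ) : 0 ≤ normCutoff ψ K t :=
  le_min zero_le_one (by positivity)

theorem normCutoff_le_one (ψ : ℝ → ℂ) (K : ℕ) (t : ℝ) : normCutoff ψ K t ≤ 1 :=
  min_le_left _ _

theorem norm_le_of_normCutoff_lt_one {ψ : ℝ → ℂ} {K : ℕ} (hK : K ≠ 0) {t : ℝ}
    (h : normCutoff ψ K t < 1) : ‖ψ t‖ ≤ K := by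
  by_contra! hc
  have hK' : (0 : ℝ) < K := by exact_mod_cast Nat.pos_of_ne_zero hK
  have : 1 ≤ ‖ψ t‖ / K := by rw [le_div_iff₀ hK']; linarith
  exact absurd h (not_lt.2 (le_min le_rfl this))

open MeasureTheory in
theorem intervalIntegrable_normCutoff {ψ : ℝ → ℂ} (hψ : NullMeasurable ψ volume) (K : ℕ)
    (a b : ℝ) : IntervalIntegrable (normCutoff ψ K) volume a b := by
  have hm : AEMeasurable (normCutoff ψ K) volume :=
    aemeasurable_const.min (hψ.aemeasurable.norm.div_const _)
  refine (intervalIntegrable_const (c := (1 : ℝ))).mono_fun' hm.aestronglyMeasurable.restrict ?_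
  refine Filter.Eventually.of_forall fun t => ?_
  change ‖normCutoff ψ K t‖ ≤ 1
  rw [Real.norm_of_nonneg (normCutoff_nonneg ψ K t)]
  exact normCutoff_le_one ψ K t

theorem periodic_normCutoff {ψ : ℝ → ℂ} {T : ℝ} (hψ : Function.Periodic ψ T) (K : ℕ) :
    Function.Periodic (normCutoff ψ K) T := fun t => by
  simp only [normCutoff, hψ t]

open MeasureTheory Filter Topology in
-- Dominated convergence, with the constant `1` as majorant. This replaces the decay of the measure
-- of `{‖ψ‖ ≥ K}` and requires no integrability of `ψ`.
theorem tendsto_integral_normCutoff {ψ : ℝ → ℂ} (hψ : NullMeasurable ψ volume) (a b : ℝ) :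
    Tendsto (fun K : ℕ => ∫ t in a..b, normCutoff ψ K t) atTop (𝓝 0) := by
  have h := intervalIntegral.tendsto_integral_filter_of_dominated_convergence
    (μ := volume) (a := a) (b := b) (F := fun K : ℕ => normCutoff ψ K) (f := fun _ => (0 : ℝ))
    (l := atTop) (fun _ => (1 : ℝ)) ?_ ?_ intervalIntegrable_const ?_
  · simpa using h
  · exact Eventually.of_forall fun K =>
      ((aemeasurable_const.min (hψ.aemeasurable.norm.div_const _)).aestronglyMeasurable).restrict
  · refine Eventually.of_forall fun K => Eventually.of_forall fun t _ => ?_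
    rw [Real.norm_of_nonneg (normCutoff_nonneg ψ K t)]
    exact normCutoff_le_one ψ K t
  · refine Eventually.of_forall fun t _ => ?_
    refine squeeze_zero (fun K => normCutoff_nonneg ψ K t) (fun K => min_le_right _ _) ?_
    exact tendsto_const_div_atTop_nhds_zero_nat _

open MeasureTheory in
/-- Off the region controlled by two cutoffs, the Birkhoff sums of a coboundary are bounded. -/
theorem ae_norm_birkhoffSum_le_or {q : ℕ} (hq : q ≠ 0) {f ψ : ℝ → ℂ}
    (h : ∀ᵐ t : ℝ, ψ t - ψ (q * t) = f t) (n : ℕ) {K : ℕ} (hK : K ≠ 0) :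
    ∀ᵐ t : ℝ, ‖birkhoffSum (fun t : ℝ => q * t) f n t‖ ≤ 2 * K ∨
      1 ≤ normCutoff ψ K t + normCutoff ψ K ((q ^ n : ℕ) * t) := by
  filter_upwards [ae_birkhoffSum_eq_sub hq h n] with t ht
  rw [or_iff_not_imp_right, not_le]
  intro hlt
  have h1 := norm_le_of_normCutoff_lt_one hK
    (lt_of_le_of_lt (le_add_of_nonneg_right (normCutoff_nonneg ψ K ((q ^ n : ℕ) * t))) hlt)
  have h2 := norm_le_of_normCutoff_lt_one hK
    (lt_of_le_of_lt (le_add_of_nonneg_left (normCutoff_nonneg ψ K t)) hlt)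
  rw [ht]
  exact (norm_sub_le _ _).trans (by linarith)

open MeasureTheory in
/-- Integrating a pointwise bound in terms of two cutoffs, which have the same integral. -/
theorem integral_le_of_cutoff {q : ℕ} (hq : q ≠ 0) {ψ : ℝ → ℂ} (hψ : IsMeasurableOnCircle ψ)
    (n K : ℕ) {X Y : ℝ → ℝ} (hX : Continuous X) (hY : Continuous Y) {A C : ℝ}
    (h : ∀ᵐ t : ℝ, X t ≤ A + Y t + C * (normCutoff ψ K t + normCutoff ψ K ((q ^ n : ℕ) * t))) :
    ∫ t in (0 : ℝ)..2 * Real.pi, X t ≤ 2 * Real.pi * A + (∫ t in (0 : ℝ)..2 * Real.pi, Y t)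
      + 2 * C * ∫ t in (0 : ℝ)..2 * Real.pi, normCutoff ψ K t := by
  have hqn : q ^ n ≠ 0 := pow_ne_zero _ hq
  have i1 : IntervalIntegrable (normCutoff ψ K) volume 0 (2 * Real.pi) :=
    intervalIntegrable_normCutoff hψ.2 K _ _
  have i2 : IntervalIntegrable (fun t => normCutoff ψ K ((q ^ n : ℕ) * t)) volume 0
      (2 * Real.pi) := by
    have hc : ((q ^ n : ℕ) : ℝ) ≠ 0 := by exact_mod_cast hqn
    have := (intervalIntegrable_normCutoff hψ.2 K 0 ((q ^ n : ℕ) * (2 * Real.pi))).comp_mul_left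
      (c := ((q ^ n : ℕ) : ℝ))
    rwa [zero_div, mul_div_cancel_left₀ _ hc] at this
  have i3 : IntervalIntegrable (fun t => A + Y t) volume 0 (2 * Real.pi) :=
    (continuous_const.add hY).intervalIntegrable _ _
  have i4 := (i1.add i2).const_mul C
  have hle := intervalIntegral.integral_mono_ae Real.two_pi_pos.le (hX.intervalIntegrable _ _)
    (i3.add i4) h
  have e : ∫ t in (0 : ℝ)..2 * Real.pi,
      ((A + Y t) + C * (normCutoff ψ K t + normCutoff ψ K ((q ^ n : ℕ) * t)))
      = 2 * Real.pi * A + (∫ t in (0 : ℝ)..2 * Real.pi, Y t)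
      + 2 * C * ∫ t in (0 : ℝ)..2 * Real.pi, normCutoff ψ K t := by
    rw [intervalIntegral.integral_add i3 i4, intervalIntegral.integral_const_mul,
      intervalIntegral.integral_add i1 i2,
      integral_periodic_comp_mul hqn (periodic_normCutoff hψ.1 K)
        (intervalIntegrable_normCutoff hψ.2 K),
      intervalIntegral.integral_add (continuous_const.intervalIntegrable _ _)
        (hY.intervalIntegrable _ _), intervalIntegral.integral_const, smul_eq_mul]
    ring
  exact hle.trans e.le

/-! ### Vanishing of means and of orthogonal coboundaries -/

open Filter Topology in
/-- A continuous function that is a measurable coboundary has mean zero. -/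
theorem integral_eq_zero_of_coboundary {q : ℕ} (hq : q ≠ 0) {f ψ : ℝ → ℂ} (hf : Continuous f)
    (hper : Function.Periodic f (2 * Real.pi)) {B : ℝ} (hB : ∀ t, ‖f t‖ ≤ B)
    (hψ : IsMeasurableOnCircle ψ) (h : ∀ᵐ t : ℝ, ψ t - ψ (q * t) = f t) :
    ∫ t in (0 : ℝ)..2 * Real.pi, f t = 0 := by
  have hB0 : 0 ≤ B := (norm_nonneg _).trans (hB 0)
  have hSB : ∀ n t, ‖birkhoffSum (fun t : ℝ => q * t) f n t‖ ≤ n * B := by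
    intro n
    induction n with
    | zero => simp
    | succ n ih =>
      intro t
      rw [birkhoffSum_succ']
      refine (norm_add_le _ _).trans ?_
      have := hB t
      have := ih (q * t)
      push_cast
      linarith
  set μ : ℕ → ℝ := fun K => ∫ t in (0 : ℝ)..2 * Real.pi, normCutoff ψ K t with hμ
  set I := ∫ t in (0 : ℝ)..2 * Real.pi, f t with hI
  -- Where the cutoffs do not give `‖S n‖ ≤ 2K`, they sum to at least `1` and the trivial bound `n *
  -- B` is charged to them; the integral is then divided by `n`.
  have key : ∀ n K : ℕ, n ≠ 0 → K ≠ 0 → ‖I‖ ≤ 4 * Real.pi * K / n + 2 * B * μ K := by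
    intro n K hn hK
    have hn' : (0 : ℝ) < n := by exact_mod_cast Nat.pos_of_ne_zero hn
    have hb := integral_le_of_cutoff (n := n) (K := K) hq hψ
      (X := fun t => ‖birkhoffSum (fun t : ℝ => q * t) f n t‖) (Y := fun _ => 0)
      (A := 2 * K) (C := n * B) (continuous_birkhoffSum_mul hf n).norm continuous_const (by
        filter_upwards [ae_norm_birkhoffSum_le_or hq h n hK] with t ht
        have h1 := normCutoff_nonneg ψ K t
        have h2 := normCutoff_nonneg ψ K ((q ^ n : ℕ) * t)
        have hnB : 0 ≤ n * B := by positivity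
        rcases ht with ht | ht
        · have := mul_nonneg hnB (add_nonneg h1 h2)
          linarith
        · have := mul_le_mul_of_nonneg_left ht hnB
          have := hSB n t
          have : (0 : ℝ) ≤ 2 * K := by positivity
          linarith)
    have hn1 : ‖(n : ℂ) * I‖ ≤ ∫ t in (0 : ℝ)..2 * Real.pi,
        ‖birkhoffSum (fun t : ℝ => q * t) f n t‖ := by
      rw [← integral_birkhoffSum_mul hq hf hper n]
      exact intervalIntegral.norm_integral_le_integral_norm Real.two_pi_pos.le
    rw [norm_mul, Complex.norm_natCast] at hn1
    have hfin := hn1.trans hb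
    simp only [intervalIntegral.integral_zero] at hfin
    rw [← sub_le_iff_le_add, le_div_iff₀ hn']
    linarith
  have step1 : ∀ K : ℕ, K ≠ 0 → ‖I‖ ≤ 2 * B * μ K := by
    intro K hK
    have ht : Tendsto (fun n : ℕ => 4 * Real.pi * K / n + 2 * B * μ K) atTop
        (𝓝 (0 + 2 * B * μ K)) :=
      (tendsto_const_div_atTop_nhds_zero_nat _).add tendsto_const_nhds
    rw [zero_add] at ht
    exact ge_of_tendsto ht ((eventually_ne_atTop 0).mono fun n hn => key n K hn hK)
  have ht : Tendsto (fun K : ℕ => 2 * B * μ K) atTop (𝓝 (2 * B * 0)) :=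
    (tendsto_integral_normCutoff hψ.2 _ _).const_mul _
  rw [mul_zero] at ht
  have := ge_of_tendsto ht ((eventually_ne_atTop 0).mono step1)
  exact norm_eq_zero.1 (le_antisymm this (norm_nonneg _))

open Filter Topology in
/-- A measurable coboundary that is orthogonal to all functions of `q t` vanishes. -/
theorem OrthToDilates.integral_norm_sq_eq_zero {q : ℕ} (hq : q ≠ 0) {f ψ : ℝ → ℂ} (hf : Continuous f)
    (hper : Function.Periodic f (2 * Real.pi)) (ho : OrthToDilates q f) {B : ℝ}
    (hB : ∀ t, ‖f t‖ ≤ B) (hψ : IsMeasurableOnCircle ψ)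
    (h : ∀ᵐ t : ℝ, ψ t - ψ (q * t) = f t) :
    ∫ t in (0 : ℝ)..2 * Real.pi, ‖f t‖ ^ 2 = 0 := by
  set μ : ℕ → ℝ := fun K => ∫ t in (0 : ℝ)..2 * Real.pi, normCutoff ψ K t with hμ
  set σ := ∫ t in (0 : ℝ)..2 * Real.pi, ‖f t‖ ^ 2 with hσ
  set M := 16 * Real.pi * B ^ 4 with hM
  have key : ∀ (δ : ℝ) (K n : ℕ), 0 < δ → K ≠ 0 → n ≠ 0 →
      σ ≤ 8 * Real.pi * K ^ 2 / n + (2 / δ * μ K + δ * M) := by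
    intro δ K n hδ hK hn
    have hn' : (0 : ℝ) < n := by exact_mod_cast Nat.pos_of_ne_zero hn
    have hS := continuous_birkhoffSum_mul (q := q) hf n
    have hb := integral_le_of_cutoff (n := n) (K := K) hq hψ
      (X := fun t => ‖birkhoffSum (fun t : ℝ => q * t) f n t‖ ^ 2)
      (Y := fun t => δ / n * ‖birkhoffSum (fun t : ℝ => q * t) f n t‖ ^ 4)
      (A := (2 * K) ^ 2) (C := n / δ) (by fun_prop) (by fun_prop) (by
        filter_upwards [ae_norm_birkhoffSum_le_or hq h n hK] with t ht
        have h1 := normCutoff_nonneg ψ K t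
        have h2 := normCutoff_nonneg ψ K ((q ^ n : ℕ) * t)
        set s := ‖birkhoffSum (fun t : ℝ => q * t) f n t‖
        have hs : 0 ≤ s := norm_nonneg _
        have hC : 0 ≤ n / δ := by positivity
        have hY : 0 ≤ δ / n * s ^ 4 := by positivity
        rcases ht with ht | ht
        · have := mul_nonneg hC (add_nonneg h1 h2)
          have : s ^ 2 ≤ (2 * K) ^ 2 := by gcongr
          linarith
        · have := mul_le_mul_of_nonneg_left ht hC
          have hprod : δ / n * (n / δ) = 1 := by field_simp
          -- Completing the square gives `s² ≤ (δ/n)s⁴ + n/(4δ)`: the quartic part is controlled by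
          -- the fourth moment, the constant by the cutoffs.
          have h3 : δ / n * (s ^ 2 - n / δ / 2) ^ 2
              = δ / n * s ^ 4 - s ^ 2 + n / δ / 4 := by
            linear_combination (- s ^ 2 + n / δ / 4) * hprod
          have h4 : 0 ≤ δ / n * (s ^ 2 - n / δ / 2) ^ 2 := by positivity
          have : (0 : ℝ) ≤ (2 * K) ^ 2 := by positivity
          linarith)
    rw [integral_norm_sq_birkhoffSum hq hf hper ho n, intervalIntegral.integral_const_mul] at hb
    have h4 : δ / n * ∫ t in (0 : ℝ)..2 * Real.pi, ‖birkhoffSum (fun t : ℝ => q * t) f n t‖ ^ 4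
        ≤ δ / n * (M * n ^ 2) :=
      mul_le_mul_of_nonneg_left (integral_norm_pow_four_birkhoffSum_le hq hf hper ho hB n)
        (by positivity)
    have h5 : δ / n * (M * n ^ 2) = δ * M * n := by field_simp
    have h6 : 2 * (n / δ) * μ K = 2 / δ * μ K * n := by ring
    rw [← sub_le_iff_le_add, le_div_iff₀ hn']
    linarith
  -- The order of limits matters: `n → ∞` removes `K ^ 2 / n`, then `K → ∞` removes `μ K / δ`, and
  -- only then `δ → 0`.
  have step1 : ∀ (δ : ℝ) (K : ℕ), 0 < δ → K ≠ 0 → σ ≤ 2 / δ * μ K + δ * M := by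
    intro δ K hδ hK
    have ht : Tendsto (fun n : ℕ => 8 * Real.pi * K ^ 2 / n + (2 / δ * μ K + δ * M)) atTop
        (𝓝 (0 + (2 / δ * μ K + δ * M))) :=
      (tendsto_const_div_atTop_nhds_zero_nat _).add tendsto_const_nhds
    rw [zero_add] at ht
    exact ge_of_tendsto ht ((eventually_ne_atTop 0).mono fun n hn => key δ K n hδ hK hn)
  have step2 : ∀ δ : ℝ, 0 < δ → σ ≤ δ * M := by
    intro δ hδ
    have ht : Tendsto (fun K : ℕ => 2 / δ * μ K + δ * M) atTop (𝓝 (2 / δ * 0 + δ * M)) :=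
      ((tendsto_integral_normCutoff hψ.2 _ _).const_mul _).add tendsto_const_nhds
    rw [mul_zero, zero_add] at ht
    exact ge_of_tendsto ht ((eventually_ne_atTop 0).mono fun K hK => step1 δ K hδ hK)
  have ht : Tendsto (fun δ : ℝ => δ * M) (𝓝[>] 0) (𝓝 (0 * M)) :=
    (tendsto_id.mono_left nhdsWithin_le_nhds).mul_const M
  rw [zero_mul] at ht
  have hle : σ ≤ 0 := ge_of_tendsto ht (eventually_mem_nhdsWithin.mono fun δ hδ => step2 δ hδ)
  exact le_antisymm hle
    (intervalIntegral.integral_nonneg Real.two_pi_pos.le fun t _ => by positivity)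

/-! ### Trigonometric sums and their coefficients -/

/-- The function `A cos x + B sin x`. -/
noncomputable def trigTerm (A B : ℂ) (x : ℝ) : ℂ :=
  A * (Real.cos x : ℂ) + B * (Real.sin x : ℂ)

theorem continuous_trigTerm (A B : ℂ) : Continuous (trigTerm A B) := by
  unfold trigTerm
  fun_prop

theorem periodic_trigTerm (A B : ℂ) : Function.Periodic (trigTerm A B) (2 * Real.pi) := by
  intro x
  simp only [trigTerm, Real.cos_add_two_pi, Real.sin_add_two_pi]

theorem norm_trigTerm_le (A B : ℂ) (x : ℝ) : ‖trigTerm A B x‖ ≤ ‖A‖ + ‖B‖ := by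
  refine (norm_add_le _ _).trans ?_
  rw [norm_mul, norm_mul, Complex.norm_real, Complex.norm_real]
  exact add_le_add (mul_le_of_le_one_right (norm_nonneg _) (Real.abs_cos_le_one x))
    (mul_le_of_le_one_right (norm_nonneg _) (Real.abs_sin_le_one x))

theorem trigTerm_eq_exp (A B : ℂ) (p : ℕ) (t : ℝ) :
    trigTerm A B (p * t) = (A - B * Complex.I) / 2 * Complex.exp ((p : ℤ) * t * Complex.I)
      + (A + B * Complex.I) / 2 * Complex.exp ((-p : ℤ) * t * Complex.I) := by
  have h1 := Complex.two_cos (p * t)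
  have h2 := Complex.two_sin (p * t)
  simp only [trigTerm]
  push_cast
  simp only [neg_mul] at h1 h2 ⊢
  linear_combination A / 2 * h1 + B / 2 * h2

theorem sum_trigTerm {ι : Type*} (s : Finset ι) (A B : ι → ℂ) (x : ℝ) :
    ∑ i ∈ s, trigTerm (A i) (B i) x = trigTerm (∑ i ∈ s, A i) (∑ i ∈ s, B i) x := by
  simp only [trigTerm, Finset.sum_add_distrib, Finset.sum_mul]

theorem continuous_sum_trigTerm (s : Finset ℕ) (A B : ℕ → ℂ) :
    Continuous fun t : ℝ => ∑ p ∈ s, trigTerm (A p) (B p) (p * t) :=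
  continuous_finsetSum s fun p _ => (continuous_trigTerm _ _).comp (by fun_prop)

theorem periodic_sum_trigTerm (s : Finset ℕ) (A B : ℕ → ℂ) :
    Function.Periodic (fun t : ℝ => ∑ p ∈ s, trigTerm (A p) (B p) (p * t)) (2 * Real.pi) :=
  fun t => Finset.sum_congr rfl fun p _ => (periodic_trigTerm _ _).comp_natCast_mul p t

theorem norm_sum_trigTerm_le (s : Finset ℕ) (A B : ℕ → ℂ) (t : ℝ) :
    ‖∑ p ∈ s, trigTerm (A p) (B p) (p * t)‖ ≤ ∑ p ∈ s, (‖A p‖ + ‖B p‖) :=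
  norm_sum_le_of_le s fun _ _ => norm_trigTerm_le _ _ _

/-- Each term is a combination of the characters of frequencies `p` and `-p`, neither divisible by
`q`. -/
theorem orthToDilates_sum_trigTerm {q : ℕ} (hq : q ≠ 0) {s : Finset ℕ} (hs : ∀ p ∈ s, ¬ q ∣ p)
    (A B : ℕ → ℂ) : OrthToDilates q fun t : ℝ => ∑ p ∈ s, trigTerm (A p) (B p) (p * t) := by
  intro g hg hper
  simp only [Finset.sum_mul]
  rw [intervalIntegral.integral_finsetSum]
  · refine Finset.sum_eq_zero fun p hp => ?_
    have h1 : ¬ (q : ℤ) ∣ (p : ℤ) := by exact_mod_cast hs p hp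
    have h2 : ¬ (q : ℤ) ∣ (-p : ℤ) := by rwa [dvd_neg]
    simp only [trigTerm_eq_exp, add_mul, mul_assoc ((_ : ℂ) / 2)]
    rw [intervalIntegral.integral_add, intervalIntegral.integral_const_mul,
      intervalIntegral.integral_const_mul, integral_exp_mul_comp_mul_eq_zero hq h1 hper,
      integral_exp_mul_comp_mul_eq_zero hq h2 hper, mul_zero, mul_zero, add_zero]
    all_goals exact Continuous.intervalIntegrable (by fun_prop) _ _
  · intro p _
    have := continuous_trigTerm (A p) (B p)
    exact Continuous.intervalIntegrable (by fun_prop) _ _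

theorem integral_exp_int_mul (k : ℤ) :
    ∫ t in (0 : ℝ)..2 * Real.pi, Complex.exp (k * t * Complex.I)
      = if k = 0 then (2 * Real.pi : ℂ) else 0 := by
  split_ifs with hk
  · subst hk
    simp
  -- A nonzero `k` is not divisible by `|k| + 1`, so the orthogonality of characters applies with
  -- that dilation and `g = 1`.
  · have hdvd : ¬ ((k.natAbs + 1 : ℕ) : ℤ) ∣ k := by
      intro h
      have := Nat.le_of_dvd (Int.natAbs_pos.2 hk) (Int.natCast_dvd.1 h)
      omega
    simpa using integral_exp_mul_comp_mul_eq_zero (Nat.succ_ne_zero k.natAbs) hdvd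
      (g := fun _ => 1) (fun _ => rfl)

/-- A trigonometric sum vanishing on a period has zero coefficients. -/
theorem coeff_eq_zero_of_sum_trigTerm_eq_zero {s : Finset ℕ} (hs : ∀ p ∈ s, p ≠ 0)
    {A B : ℕ → ℂ}
    (h : ∀ t ∈ Set.Icc (0 : ℝ) (2 * Real.pi), ∑ p ∈ s, trigTerm (A p) (B p) (p * t) = 0) :
    ∀ p ∈ s, A p = 0 ∧ B p = 0 := by
  have key : ∀ m : ℤ, ∑ p ∈ s, ((A p - B p * Complex.I) / 2 *
        (if (p + m : ℤ) = 0 then (2 * Real.pi : ℂ) else 0)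
      + (A p + B p * Complex.I) / 2 * (if (-p + m : ℤ) = 0 then (2 * Real.pi : ℂ) else 0)) = 0 := by
    intro m
    have h0 : ∫ t in (0 : ℝ)..2 * Real.pi,
        (∑ p ∈ s, trigTerm (A p) (B p) (p * t)) * Complex.exp (m * t * Complex.I) = 0 := by
      refine intervalIntegral.integral_zero_ae (Filter.Eventually.of_forall fun t ht => ?_)
      rw [Set.uIoc_of_le Real.two_pi_pos.le] at ht
      rw [h t (Set.Ioc_subset_Icc_self ht), zero_mul]
    have e : ∀ t : ℝ, (∑ p ∈ s, trigTerm (A p) (B p) (p * t)) * Complex.exp (m * t * Complex.I)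
        = ∑ p ∈ s, ((A p - B p * Complex.I) / 2 * Complex.exp ((p + m : ℤ) * t * Complex.I)
          + (A p + B p * Complex.I) / 2 * Complex.exp ((-p + m : ℤ) * t * Complex.I)) := by
      intro t
      rw [Finset.sum_mul]
      refine Finset.sum_congr rfl fun p _ => ?_
      rw [trigTerm_eq_exp, add_mul, mul_assoc (_ / 2), mul_assoc (_ / 2), ← Complex.exp_add,
        ← Complex.exp_add]
      push_cast
      simp only [add_mul]
    simp only [e] at h0
    refine Eq.trans ?_ h0
    rw [intervalIntegral.integral_finsetSum]
    · refine Finset.sum_congr rfl fun p _ => ?_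
      rw [intervalIntegral.integral_add, intervalIntegral.integral_const_mul,
        intervalIntegral.integral_const_mul, integral_exp_int_mul, integral_exp_int_mul]
      all_goals exact Continuous.intervalIntegrable (by fun_prop) _ _
    · intro p _
      exact Continuous.intervalIntegrable (by fun_prop) _ _
  have hpi : (2 * Real.pi : ℂ) ≠ 0 := by
    exact_mod_cast Real.two_pi_pos.ne'
  intro p hp
  have hp0 := hs p hp
  -- Testing against the frequencies `-p` and `p` isolates `A p - i B p` and `A p + i B p`; they do
  -- not mix because `p ≠ 0`.
  have h1 := key (-p)
  have h2 := key p
  rw [Finset.sum_eq_single_of_mem p hp] at h1 h2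
  · rw [if_pos (by omega), if_neg (by omega)] at h1
    rw [if_neg (by omega), if_pos (by omega)] at h2
    rw [mul_zero, add_zero, mul_eq_zero, or_iff_left hpi] at h1
    rw [mul_zero, zero_add, mul_eq_zero, or_iff_left hpi] at h2
    have hA : A p = 0 := by linear_combination h1 + h2
    refine ⟨hA, ?_⟩
    have : B p * Complex.I = 0 := by linear_combination h2 - h1
    exact (mul_eq_zero.1 this).resolve_right Complex.I_ne_zero
  · intro k hk hkp
    have := hs k hk
    rw [if_neg (by omega), if_neg (by omega)]
    simp
  · intro k hk hkp
    have := hs k hk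
    rw [if_neg (by omega), if_neg (by omega)]
    simp

/-! ### Moving frequencies along orbits by coboundaries -/

theorem isMeasurableOnCircle_of_continuous {ψ : ℝ → ℂ} (hc : Continuous ψ)
    (hp : Function.Periodic ψ (2 * Real.pi)) : IsMeasurableOnCircle ψ :=
  ⟨hp, hc.measurable.nullMeasurable⟩

theorem IsMeasurableOnCircle.add {ψ φ : ℝ → ℂ} (hψ : IsMeasurableOnCircle ψ)
    (hφ : IsMeasurableOnCircle φ) : IsMeasurableOnCircle (ψ + φ) :=
  ⟨hψ.1.add hφ.1, (hψ.2.aemeasurable.add hφ.2.aemeasurable).nullMeasurable⟩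

theorem IsMeasurableOnCircle.neg {ψ : ℝ → ℂ} (hψ : IsMeasurableOnCircle ψ) :
    IsMeasurableOnCircle (-ψ) :=
  ⟨fun t => congrArg Neg.neg (hψ.1 t), hψ.2.aemeasurable.neg.nullMeasurable⟩

/-- Telescoping: minus the Birkhoff sum of `g` of length `i` is a solution. -/
theorem exists_sub_comp_eq_comp_pow_sub {q : ℕ} {g : ℝ → ℂ} (hc : Continuous g)
    (hp : Function.Periodic g (2 * Real.pi)) (i : ℕ) :
    ∃ ψ : ℝ → ℂ, IsMeasurableOnCircle ψ ∧
      ∀ t : ℝ, ψ t - ψ (q * t) = g ((q : ℝ) ^ i * t) - g t := by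
  refine ⟨-birkhoffSum (fun t : ℝ => q * t) g i, (isMeasurableOnCircle_of_continuous
    (continuous_birkhoffSum_mul hc i) (periodic_birkhoffSum_mul hp i)).neg, fun t => ?_⟩
  have h := birkhoffSum_apply_sub_birkhoffSum (fun t : ℝ => (q : ℝ) * t) g i t
  rw [mul_left_iterate] at h
  rw [← h]
  simp only [Pi.neg_apply]
  ring

theorem exists_sub_comp_eq_sum {q : ℕ} {ι : Type*} (s : Finset ι) {θ : ι → ℝ → ℂ}
    (h : ∀ i ∈ s, ∃ ψ : ℝ → ℂ, IsMeasurableOnCircle ψ ∧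
      ∀ t : ℝ, ψ t - ψ (q * t) = θ i t) :
    ∃ ψ : ℝ → ℂ, IsMeasurableOnCircle ψ ∧
      ∀ t : ℝ, ψ t - ψ (q * t) = ∑ i ∈ s, θ i t := by
  classical
  induction s using Finset.induction_on with
  | empty =>
    exact ⟨0, isMeasurableOnCircle_of_continuous continuous_const fun _ => rfl, by simp⟩
  | insert i s hi ih =>
    obtain ⟨ψ, hψ, e⟩ := ih fun j hj => h j (Finset.mem_insert_of_mem hj)
    obtain ⟨φ, hφ, e'⟩ := h i (Finset.mem_insert_self i s)
    refine ⟨φ + ψ, hφ.add hψ, fun t => ?_⟩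
    rw [Finset.sum_insert hi, ← e, ← e']
    simp only [Pi.add_apply]
    ring

/-- Up to a coboundary, all the terms of an orbit of frequencies can be moved to its base. -/
theorem exists_sub_comp_eq_orbit_sum {q : ℕ} (s : Finset ℕ) (m : ℕ → ℕ) (a b : ℕ → ℕ → ℂ) :
    ∃ ψ : ℝ → ℂ, IsMeasurableOnCircle ψ ∧ ∀ t : ℝ, ψ t - ψ (q * t) =
      (∑ p ∈ s, ∑ i ∈ Finset.range (m p), trigTerm (a p i) (b p i) ((p : ℝ) * (q : ℝ) ^ i * t))
      - ∑ p ∈ s, trigTerm (∑ i ∈ Finset.range (m p), a p i) (∑ i ∈ Finset.range (m p), b p i)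
        (p * t) := by
  have h := exists_sub_comp_eq_sum (q := q) s
    (θ := fun p t => ∑ i ∈ Finset.range (m p), (trigTerm (a p i) (b p i) (p * ((q : ℝ) ^ i * t))
      - trigTerm (a p i) (b p i) (p * t))) fun p _ =>
    exists_sub_comp_eq_sum _ fun i _ =>
      exists_sub_comp_eq_comp_pow_sub (g := fun t => trigTerm (a p i) (b p i) (p * t))
        ((continuous_trigTerm _ _).comp (by fun_prop))
        ((periodic_trigTerm _ _).comp_natCast_mul p) i
  obtain ⟨ψ, hψ, e⟩ := h
  refine ⟨ψ, hψ, fun t => ?_⟩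
  rw [e]
  simp only [Finset.sum_sub_distrib, sum_trigTerm, mul_assoc]

/-! ### Trigonometric polynomials and grouping of frequencies -/

theorem isTrigPoly_trigTerm (A B : ℂ) (k : ℕ) : IsTrigPoly fun t => trigTerm A B (k * t) := by
  refine ⟨k, fun j => if j = k then A else 0, fun j => if j = k then B else 0, fun t => ?_⟩
  rw [Finset.sum_eq_single_of_mem k (Finset.self_mem_range_succ k)]
  · simp [trigTerm]
  · intro j _ hj
    simp [hj]

/-- Extending the coefficients by zero beyond the degree lets the summation range be enlarged at
will, for adding polynomials and for choosing `d`. -/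
theorem isTrigPoly_iff_support_le {θ : ℝ → ℂ} : IsTrigPoly θ ↔
    ∃ (N : ℕ) (a b : ℕ → ℂ), (∀ k, N < k → a k = 0 ∧ b k = 0) ∧ ∀ M, N ≤ M → ∀ t : ℝ,
      θ t = ∑ k ∈ Finset.range (M + 1), trigTerm (a k) (b k) (k * t) := by
  constructor
  · rintro ⟨N, a, b, h⟩
    refine ⟨N, fun k => if k ≤ N then a k else 0, fun k => if k ≤ N then b k else 0,
      fun k hk => by simp [not_le.2 hk], fun M hM t => ?_⟩
    rw [h t, ← Finset.sum_subset (Finset.range_mono (Nat.succ_le_succ hM))]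
    · refine Finset.sum_congr rfl fun k hk => ?_
      simp [trigTerm, Nat.lt_succ_iff.1 (Finset.mem_range.1 hk)]
    · intro k _ hk
      have : ¬ k ≤ N := fun h => hk (Finset.mem_range.2 (Nat.lt_succ_of_le h))
      simp [trigTerm, this]
  · rintro ⟨N, a, b, -, h⟩
    exact ⟨N, a, b, h N le_rfl⟩

theorem IsTrigPoly.add {θ η : ℝ → ℂ} (hθ : IsTrigPoly θ) (hη : IsTrigPoly η) :
    IsTrigPoly fun t => θ t + η t := by
  obtain ⟨N, a, b, -, h⟩ := isTrigPoly_iff_support_le.1 hθ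
  obtain ⟨M, a', b', -, h'⟩ := isTrigPoly_iff_support_le.1 hη
  refine ⟨max N M, a + a', b + b', fun t => ?_⟩
  change θ t + η t = _
  rw [h _ (le_max_left N M), h' _ (le_max_right N M), ← Finset.sum_add_distrib]
  refine Finset.sum_congr rfl fun k _ => ?_
  simp only [trigTerm, Pi.add_apply]
  ring

theorem IsTrigPoly.sum {ι : Type*} (s : Finset ι) {θ : ι → ℝ → ℂ}
    (h : ∀ i ∈ s, IsTrigPoly (θ i)) : IsTrigPoly fun t => ∑ i ∈ s, θ i t := by
  classical
  induction s using Finset.induction_on with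
  | empty => exact ⟨0, 0, 0, by simp⟩
  | insert i s hi ih =>
    simp only [Finset.sum_insert hi]
    exact (h i (Finset.mem_insert_self i s)).add
      (ih fun j hj => h j (Finset.mem_insert_of_mem hj))

theorem lt_mul_pow_topExponent {q d p : ℕ} (hq : 2 ≤ q) (hp : 1 ≤ p) :
    d < p * q ^ topExponent q d p := by
  have : {i : ℕ | d < p * q ^ i}.Nonempty :=
    ⟨d, (Nat.lt_pow_self hq).trans_le (Nat.le_mul_of_pos_left _ hp)⟩
  exact Nat.sInf_mem this

theorem le_topExponent_of_mul_pow_le {q d p i : ℕ} (hq : 2 ≤ q) (hp : 1 ≤ p)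
    (h : p * q ^ i ≤ d) : i ≤ topExponent q d p := by
  by_contra! hlt
  have h1 := lt_mul_pow_topExponent (d := d) hq hp
  have h2 : p * q ^ topExponent q d p ≤ p * q ^ i :=
    Nat.mul_le_mul_left _ (Nat.pow_le_pow_right (by omega) hlt.le)
  omega

/-- Otherwise cancelling `q ^ i` leaves a factor `q` in `p`. Applied in both directions, this makes
`(p, i) ↦ p * q ^ i` injective on bases not divisible by `q`. -/
theorem le_of_mul_pow_eq_mul_pow {q p p' i i' : ℕ} (hq : 2 ≤ q) (hp : ¬ q ∣ p)
    (h : p * q ^ i = p' * q ^ i') : i' ≤ i := by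
  by_contra! hlt
  obtain ⟨j, rfl⟩ := Nat.exists_eq_add_of_lt hlt
  have hpos : 0 < q ^ i := Nat.pow_pos (by omega)
  have : p = p' * q ^ j * q := by
    apply Nat.eq_of_mul_eq_mul_right hpos
    rw [h]
    ring
  exact hp (this ▸ dvd_mul_left _ _)

/-- Summation over the frequencies `k = p q ^ i` with `q ∤ p`, grouped by `p`. -/
theorem sum_range_eq_sum_baseFreqs {q d : ℕ} (hq : 2 ≤ q) {g : ℕ → ℂ}
    (hg : ∀ k, d < k → g k = 0) :
    ∑ k ∈ Finset.range (d + 1), g k = g 0 +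
      ∑ p ∈ baseFreqs q d, ∑ i ∈ Finset.range (topExponent q d p + 1), g (p * q ^ i) := by
  have h0 : ∑ k ∈ Finset.range (d + 1), g k = g 0 + ∑ k ∈ Finset.Icc 1 d, g k := by
    rw [Finset.range_eq_Ico, Finset.sum_eq_sum_Ico_succ_bot (Nat.succ_pos d)]
    rfl
  -- The exponent `topExponent q d p` already gives a frequency above `d`, where `g` vanishes. After
  -- discarding such pairs, `(p, i) ↦ p * q ^ i` is a bijection onto `{1, ..., d}`.
  rw [h0, Finset.sum_sigma', ← Finset.sum_filter_of_ne 
    (p := fun x : (_ : ℕ) × ℕ => x.1 * q ^ x.2 ≤ d)]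
  · congr 1
    symm
    refine Finset.sum_nbij (fun x : (_ : ℕ) × ℕ => x.1 * q ^ x.2) ?_ ?_ ?_ (fun _ _ => rfl)
    · rintro ⟨p, i⟩ hx
      simp only [Finset.mem_filter, Finset.mem_sigma, baseFreqs, Finset.mem_Icc] at hx ⊢
      exact ⟨Nat.mul_pos hx.1.1.1.1 (Nat.pow_pos (by omega)), hx.2⟩
    · rintro ⟨p, i⟩ hx ⟨p', i'⟩ hx' h
      simp only [Finset.coe_filter, Finset.mem_sigma, baseFreqs, Finset.mem_filter,
        Set.mem_ofPred_eq] at hx hx' h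
      obtain rfl : i = i' := le_antisymm (le_of_mul_pow_eq_mul_pow hq hx'.1.1.2 h.symm)
        (le_of_mul_pow_eq_mul_pow hq hx.1.1.2 h)
      obtain rfl := Nat.eq_of_mul_eq_mul_right (Nat.pow_pos (by omega)) h
      rfl
    · intro k hk
      rw [Finset.mem_coe, Finset.mem_Icc] at hk
      obtain ⟨e, p, hp, rfl⟩ := Nat.exists_eq_pow_mul_and_not_dvd (n := k) (by omega) q (by omega)
      have hp1 : 1 ≤ p := Nat.pos_of_ne_zero fun h => hp (h ▸ dvd_zero _)
      have hle : p * q ^ e ≤ d := by rw [mul_comm]; exact hk.2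
      have hpd : p ≤ d := (Nat.le_mul_of_pos_right _ (Nat.pow_pos (by omega))).trans hle
      refine ⟨⟨p, e⟩, ?_, mul_comm _ _⟩
      simp only [Finset.coe_filter, Finset.mem_sigma, baseFreqs, Finset.mem_filter,
        Set.mem_ofPred_eq, Finset.mem_Icc, Finset.mem_range]
      exact ⟨⟨⟨⟨hp1, hpd⟩, hp⟩, Nat.lt_succ_of_le (le_topExponent_of_mul_pow_le hq hp1 hle)⟩, hle⟩
  · intro x _ hx
    by_contra! hlt
    exact hx (hg _ hlt)

/-! ### The two implications -/

theorem HasCoboundaryForm.isTrigCoboundary {q : ℕ} {θ : ℝ → ℂ} (h : HasCoboundaryForm q θ) :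
    IsTrigCoboundary q θ := by
  obtain ⟨d, -, a, b, hsum, hθ⟩ := h
  constructor
  · have e : θ = fun t => ∑ p ∈ baseFreqs q d, ∑ i ∈ Finset.range (topExponent q d p + 1),
        trigTerm (a p i) (b p i) ((p * q ^ i : ℕ) * t) := by
      ext t
      simp only [hθ t, trigTerm]
      push_cast
      rfl
    rw [e]
    exact IsTrigPoly.sum _ fun p _ => IsTrigPoly.sum _ fun i _ => isTrigPoly_trigTerm _ _ _
  · obtain ⟨ψ, hψ, e⟩ := exists_sub_comp_eq_orbit_sum (q := q) (baseFreqs q d)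
      (fun p => topExponent q d p + 1) a b
    refine ⟨ψ, hψ, fun t => ?_⟩
    rw [e, hθ t, sub_eq_self.2]
    · rfl
    · refine Finset.sum_eq_zero fun p hp => ?_
      rw [(hsum p hp).1, (hsum p hp).2]
      simp [trigTerm]

theorem IsTrigCoboundary.isTrigCoboundaryAE {q : ℕ} {θ : ℝ → ℂ} (h : IsTrigCoboundary q θ) :
    IsTrigCoboundaryAE q θ :=
  let ⟨hθ, ψ, hψ, e⟩ := h
  ⟨hθ, ψ, hψ, Filter.Eventually.of_forall e⟩

/-- A measurable coboundary with constant term and frequencies not divisible by `q` is zero. -/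
theorem eq_zero_of_base_coboundary {q : ℕ} (hq : q ≠ 0) {s : Finset ℕ} (hs : ∀ p ∈ s, ¬ q ∣ p)
    {c : ℂ} {A B : ℕ → ℂ} {ψ : ℝ → ℂ} (hψ : IsMeasurableOnCircle ψ)
    (h : ∀ᵐ t : ℝ, ψ t - ψ (q * t) = c + ∑ p ∈ s, trigTerm (A p) (B p) (p * t)) :
    c = 0 ∧ ∀ p ∈ s, A p = 0 ∧ B p = 0 := by
  set f : ℝ → ℂ := fun t => ∑ p ∈ s, trigTerm (A p) (B p) (p * t) with hf
  have hfc : Continuous f := continuous_sum_trigTerm s A B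
  have hfp : Function.Periodic f (2 * Real.pi) := periodic_sum_trigTerm s A B
  have hfo : OrthToDilates q f := orthToDilates_sum_trigTerm hq hs A B
  have hfB := norm_sum_trigTerm_le s A B
  have hf0 : ∫ t in (0 : ℝ)..2 * Real.pi, f t = 0 := by
    simpa using hfo (fun _ => 1) continuous_const fun _ => rfl
  -- A constant is itself a function of `q * t`, so orthogonality cannot detect it. It is the mean
  -- value of `c + f`, and is removed first.
  have hc : c = 0 := by
    have := integral_eq_zero_of_coboundary hq (f := fun t => c + f t) (by fun_prop)
      (fun t => by simp only [hfp t]) (B := ‖c‖ + ∑ p ∈ s, (‖A p‖ + ‖B p‖))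
      (fun t => (norm_add_le _ _).trans (by gcongr; exact hfB t)) hψ h
    rw [intervalIntegral.integral_add (continuous_const.intervalIntegrable _ _)
      (hfc.intervalIntegrable _ _), hf0, intervalIntegral.integral_const, add_zero, sub_zero,
      smul_eq_zero] at this
    exact this.resolve_left Real.two_pi_pos.ne'
  subst hc
  refine ⟨rfl, coeff_eq_zero_of_sum_trigTerm_eq_zero
    (fun p hp h0 => hs p hp (h0 ▸ dvd_zero _)) fun t ht => ?_⟩
  have hint := hfo.integral_norm_sq_eq_zero hq hfc hfp hfB hψ (by simpa only [zero_add] using h)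
  by_contra hne
  refine (intervalIntegral.integral_pos Real.two_pi_pos (f := fun t => ‖f t‖ ^ 2)
    (by fun_prop) (fun _ _ => by positivity) ⟨t, ht, ?_⟩).ne' hint
  exact pow_pos (norm_pos_iff.2 hne) 2

theorem IsTrigCoboundaryAE.hasCoboundaryForm {q : ℕ} (hq : 2 ≤ q) {θ : ℝ → ℂ}
    (h : IsTrigCoboundaryAE q θ) : HasCoboundaryForm q θ := by
  obtain ⟨hθ, ψ, hψ, hae⟩ := h
  obtain ⟨N, a, b, hsupp, hθ⟩ := isTrigPoly_iff_support_le.1 hθ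
  -- The choice `d = N + 1` ensures `d ≥ 1` even when `N = 0`.
  have hsplit : ∀ t, θ t = a 0 + ∑ p ∈ baseFreqs q (N + 1),
      ∑ i ∈ Finset.range (topExponent q (N + 1) p + 1),
        trigTerm (a (p * q ^ i)) (b (p * q ^ i)) ((p : ℝ) * (q : ℝ) ^ i * t) := by
    intro t
    rw [hθ (N + 1) (Nat.le_succ N) t, sum_range_eq_sum_baseFreqs hq]
    · simp [trigTerm]
    · intro k hk
      obtain ⟨h1, h2⟩ := hsupp k (by omega)
      simp [trigTerm, h1, h2]
  obtain ⟨φ, hφ, e⟩ := exists_sub_comp_eq_orbit_sum (q := q) (baseFreqs q (N + 1))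
    (fun p => topExponent q (N + 1) p + 1) (fun p i => a (p * q ^ i)) (fun p i => b (p * q ^ i))
  obtain ⟨h0, hz⟩ := eq_zero_of_base_coboundary (q := q) (by omega)
    (s := baseFreqs q (N + 1)) (fun p hp => (Finset.mem_filter.1 hp).2) (c := a 0)
    (A := fun p => ∑ i ∈ Finset.range (topExponent q (N + 1) p + 1), a (p * q ^ i))
    (B := fun p => ∑ i ∈ Finset.range (topExponent q (N + 1) p + 1), b (p * q ^ i))
    -- Subtracting the transfer function `φ` from `ψ` leaves a solution whose right side has only
    -- the constant and the base frequencies, with the orbit sums as coefficients.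
    (hψ.add hφ.neg) (by
      filter_upwards [hae] with t ht
      simp only [Pi.add_apply, Pi.neg_apply]
      linear_combination ht - e t + hsplit t)
  refine ⟨N + 1, Nat.succ_pos N, fun p i => a (p * q ^ i), fun p i => b (p * q ^ i), hz,
    fun t => ?_⟩
  rw [hsplit t, h0, zero_add]
  rfl

theorem theorem4p6 (q : ℕ) (hq : 2 ≤ q) (θ : ℝ → ℂ) :
    (IsTrigCoboundary q θ ↔ HasCoboundaryForm q θ) ∧
      (IsTrigCoboundaryAE q θ ↔ HasCoboundaryForm q θ) :=
  ⟨⟨fun h => h.isTrigCoboundaryAE.hasCoboundaryForm hq, fun h => h.isTrigCoboundary⟩,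
    ⟨fun h => h.hasCoboundaryForm hq, fun h => h.isTrigCoboundary.isTrigCoboundaryAE⟩⟩
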